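/- Let $k$ be a field and let $A$ be an associative unital $k$-algebra which is generated as a $k$-algebra by a countable set, which is not PI (no nonzero element of a free algebra $k\langle x_0,x_1,\dots\rangle$ vanishes under all substitutions from $A$), and which is just infinite ($\dim_k A=\infty$ and every nonzero two-sided ideal of $A$ has finite codimension). For $n\ge 1$ let $I_n(A)$ be the two-sided ideal of $A$ generated by all specializations in $A$ of all polynomial identities of the matrix algebra $M_n(k)$. For a prime $k$-algebra $A$ let $Q(A)$ be its right Martindale ring of quotients: the classes of pairs $(I,f)$ with $0\ne I\lhd A$ and $f\colon I\to A$ a homomorphism of right $A$-modules, where $(I,f)\sim(J,g)$ iff $f=g$ on $I\cap J$, with $(I,f)+(J,g)=(I\cap J,f+g)$ and $(I,f)(J,g)=(JI,f\circ g)$. The extended center of $A$ is $C(A)=Z(Q(A))$. Then $A$ is prime, and: 1. $C(A)$ is a field extension of $k$ of (finite or infinite) countable dimension over $k$. 2. $I_n(A)\neq 0$ for every $n\ge 1$, and every nonzero two-sided ideal of $A$ contains $I_n(A)$ for some $n\ge 1$. 3. If $I\lhd A$, $n\ge1$ and $I_n(A)\subseteq I$, then two $(A,A)$-bimodule homomorphisms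 $I\to A$ that agree on $I_n(A)$ are equal. Moreover every element of $C(A)$ is the class of a pair $(I_n(A),f)$ for some $n\ge 1$ and some $(A,A)$-bimodule homomorphism $f\colon I_n(A)\to A$. -/

import Mathlib

namespace JustInf

open MulOpposite

/-! ## Just infinite algebras, polynomial identities and the ideals `I_n(A)` -/

section Algebras

universe u v

variable (k : Type u) (A : Type v) [Field k] [Ring A] [Algebra k A]

/-- `A` is just infinite (dimensional) over `k`: it is infinite dimensional, and every nonzero
two-sided ideal has finite codimension. -/
structure IsJustInfinite : Prop where
  infinite : ¬ Module.Finite k A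
  finite_codim : ∀ I : TwoSidedIdeal A, I ≠ ⊥ → Module.Finite k I.ringCon.Quotient

/-- `A` is generated, as a `k`-algebra, by a countable set. -/
def IsCountablyGenerated : Prop :=
  ∃ s : Set A, s.Countable ∧ Algebra.adjoin k s = ⊤

/-- `f ∈ k⟨x₀, x₁, …⟩` is a polynomial identity of `A`: all specializations of `f` in `A` vanish. -/
def IsIdentity (f : FreeAlgebra k ℕ) : Prop :=
  ∀ x : ℕ → A, FreeAlgebra.lift k x f = 0

/-- `A` is a PI algebra: it satisfies a nonzero polynomial identity. -/
def IsPI : Prop :=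
  ∃ f : FreeAlgebra k ℕ, f ≠ 0 ∧ IsIdentity k A f

/-- `I_n(A)`: the two-sided ideal of `A` generated by all specializations in `A` of all polynomial
identities of the algebra of `n × n` matrices over `k`. -/
def matIdeal (n : ℕ) : TwoSidedIdeal A :=
  TwoSidedIdeal.span {a | ∃ f : FreeAlgebra k ℕ, IsIdentity k (Matrix (Fin n) (Fin n) k) f ∧
    ∃ x : ℕ → A, FreeAlgebra.lift k x f = a}

end Algebras

/-! ## The right Martindale ring of quotients -/

universe v

/-- A ring is prime if it is nontrivial and the product of two nonzero two-sided ideals is never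
zero. -/
class IsPrimeRing (A : Type v) [Ring A] : Prop where
  nontrivial : Nontrivial A
  eq_bot_or_eq_bot : ∀ I J : TwoSidedIdeal A, (∀ x ∈ I, ∀ y ∈ J, x * y = 0) → I = ⊥ ∨ J = ⊥

section Martindale

variable {A : Type v} [Ring A]

/-- A right `A`-module homomorphism `f : I → A` on a two-sided ideal `I` is a homomorphism of
`(A, A)`-bimodules if it also commutes with left multiplication. -/
def IsBimoduleHom {I : TwoSidedIdeal A} (f : I →ₗ[Aᵐᵒᵖ] A) : Prop :=
  ∀ (a : A) (x : I), f (a • x) = a * f x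

/-- The product `JI` of two-sided ideals. -/
def idealMul (J I : TwoSidedIdeal A) : TwoSidedIdeal A :=
  TwoSidedIdeal.span {x | ∃ y ∈ J, ∃ z ∈ I, y * z = x}

lemma idealMul_induction {J I : TwoSidedIdeal A} {p : A → Prop}
    (mul : ∀ y ∈ J, ∀ z ∈ I, p (y * z)) (zero : p 0)
    (add : ∀ x y, x ∈ idealMul J I → y ∈ idealMul J I → p x → p y → p (x + y))
    (neg : ∀ x, x ∈ idealMul J I → p x → p (-x))
    {x : A} (hx : x ∈ idealMul J I) : p x := by
  have key : ∀ z, z ∈ idealMul J I ↔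
      z ∈ AddSubgroup.closure {x | ∃ y ∈ J, ∃ z ∈ I, y * z = x} := fun z =>
    TwoSidedIdeal.mem_span_iff_mem_addSubgroup_closure_absorbing
      (by rintro a _ ⟨y, hy, z, hz, rfl⟩
          exact ⟨a * y, J.mul_mem_left _ _ hy, z, hz, mul_assoc _ _ _⟩)
      (by rintro _ a ⟨y, hy, z, hz, rfl⟩
          exact ⟨y, hy, z * a, I.mul_mem_right _ _ hz, (mul_assoc _ _ _).symm⟩)
  have hx' := (key x).1 hx
  induction hx' using AddSubgroup.closure_induction with
  | mem x h => obtain ⟨y, hy, z, hz, rfl⟩ := h; exact mul y hy z hz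
  | zero => exact zero
  | add x y h1 h2 ih1 ih2 =>
    exact add x y ((key x).2 h1) ((key y).2 h2) (ih1 ((key x).2 h1)) (ih2 ((key y).2 h2))
  | neg x h ih => exact neg x ((key x).2 h) (ih ((key x).2 h))

lemma mul_mem_idealMul {J I : TwoSidedIdeal A} {y z : A} (hy : y ∈ J) (hz : z ∈ I) :
    y * z ∈ idealMul J I :=
  TwoSidedIdeal.subset_span ⟨y, hy, z, hz, rfl⟩

lemma idealMul_le_left {J I : TwoSidedIdeal A} : idealMul J I ≤ J :=
  TwoSidedIdeal.span_le.2 (by rintro _ ⟨y, hy, z, _, rfl⟩; exact J.mul_mem_right _ _ hy)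

lemma idealMul_le_right {J I : TwoSidedIdeal A} : idealMul J I ≤ I :=
  TwoSidedIdeal.span_le.2 (by rintro _ ⟨y, _, z, hz, rfl⟩; exact I.mul_mem_left _ _ hz)

lemma idealMul_ne_bot [IsPrimeRing A] {J I : TwoSidedIdeal A} (hJ : J ≠ ⊥) (hI : I ≠ ⊥) :
    idealMul J I ≠ ⊥ := by
  intro h
  rcases IsPrimeRing.eq_bot_or_eq_bot J I (fun x hx y hy => by
    have := mul_mem_idealMul hx hy
    rwa [h, TwoSidedIdeal.mem_bot] at this) with h | h
  exacts [hJ h, hI h]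

lemma inf_ne_bot [IsPrimeRing A] {J I : TwoSidedIdeal A} (hJ : J ≠ ⊥) (hI : I ≠ ⊥) :
    J ⊓ I ≠ ⊥ := fun h =>
  idealMul_ne_bot hJ hI (le_bot_iff.1 (h ▸ le_inf idealMul_le_left idealMul_le_right))

lemma top_ne_bot' [IsPrimeRing A] : (⊤ : TwoSidedIdeal A) ≠ ⊥ := by
  have := IsPrimeRing.nontrivial (A := A)
  intro h
  have : (1 : A) ∈ (⊤ : TwoSidedIdeal A) := trivial
  rw [h, TwoSidedIdeal.mem_bot] at this
  exact one_ne_zero this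

/-- In a prime ring the left annihilator of a nonzero two-sided ideal is zero. -/
lemma eq_zero_of_mul_eq_zero [IsPrimeRing A] {I : TwoSidedIdeal A} (hI : I ≠ ⊥) {d : A}
    (hd : ∀ y ∈ I, d * y = 0) : d = 0 := by
  let L : TwoSidedIdeal A := TwoSidedIdeal.mk' {d | ∀ y ∈ I, d * y = 0}
    (fun y _ => zero_mul y)
    (fun {a b} ha hb y hy => by rw [add_mul, ha y hy, hb y hy, add_zero])
    (fun {a} ha y hy => by rw [neg_mul, ha y hy, neg_zero])
    (fun {a b} hb y hy => by rw [mul_assoc, hb y hy, mul_zero])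
    (fun {a b} ha y hy => by rw [mul_assoc]; exact ha _ (I.mul_mem_left _ _ hy))
  have hL : ∀ x, x ∈ L ↔ ∀ y ∈ I, x * y = 0 := fun x => TwoSidedIdeal.mem_mk' _ _ _ _ _ _ x
  rcases IsPrimeRing.eq_bot_or_eq_bot L I (fun x hx y hy => (hL x).1 hx y hy) with h | h
  · have := (hL d).2 hd
    rwa [h, TwoSidedIdeal.mem_bot] at this
  · exact absurd h hI

variable (A) in
/-- Pairs `(I, f)` of a nonzero two-sided ideal `I` of `A` and a right `A`-module homomorphism
`f : I → A`. -/
structure PartialHom where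
  dom : TwoSidedIdeal A
  dom_ne_bot : dom ≠ ⊥
  hom : dom →ₗ[Aᵐᵒᵖ] A

namespace PartialHom

/-- Restriction of a homomorphism to a smaller ideal. -/
def restr {I J : TwoSidedIdeal A} (h : J ≤ I) (f : I →ₗ[Aᵐᵒᵖ] A) : J →ₗ[Aᵐᵒᵖ] A where
  toFun x := f ⟨x, h x.2⟩
  map_add' x y := f.map_add ⟨x, h x.2⟩ ⟨y, h y.2⟩
  map_smul' a x := f.map_smul a ⟨x, h x.2⟩

lemma hom_mul {I : TwoSidedIdeal A} (f : I →ₗ[Aᵐᵒᵖ] A) {x : A} (hx : x ∈ I) (a : A)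
    (hxa : x * a ∈ I) : f ⟨x * a, hxa⟩ = f ⟨x, hx⟩ * a :=
  f.map_smul (op a) ⟨x, hx⟩

lemma hom_mem {I J : TwoSidedIdeal A} (g : J →ₗ[Aᵐᵒᵖ] A) {x : A} (hx : x ∈ idealMul J I) :
    g ⟨x, idealMul_le_left hx⟩ ∈ I := by
  suffices h : ∃ hx : x ∈ J, g ⟨x, hx⟩ ∈ I from h.2
  refine idealMul_induction (p := fun x => ∃ hx : x ∈ J, g ⟨x, hx⟩ ∈ I) ?_ ?_ ?_ ?_ hx
  · intro y hy z hz
    refine ⟨J.mul_mem_right _ _ hy, ?_⟩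
    rw [hom_mul g hy z]
    exact I.mul_mem_left _ _ hz
  · refine ⟨J.zero_mem, ?_⟩
    have : g ⟨0, J.zero_mem⟩ = 0 := g.map_zero
    rw [this]; exact I.zero_mem
  · rintro x y - - ⟨hx, hx'⟩ ⟨hy, hy'⟩
    refine ⟨J.add_mem hx hy, ?_⟩
    have : g ⟨x + y, J.add_mem hx hy⟩ = g ⟨x, hx⟩ + g ⟨y, hy⟩ := g.map_add ⟨x, hx⟩ ⟨y, hy⟩
    rw [this]; exact I.add_mem hx' hy'
  · rintro x - ⟨hx, hx'⟩
    refine ⟨J.neg_mem hx, ?_⟩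
    have : g ⟨-x, J.neg_mem hx⟩ = -g ⟨x, hx⟩ := g.map_neg ⟨x, hx⟩
    rw [this]; exact I.neg_mem hx'

lemma congr_hom (p : PartialHom A) {x y : A} (h : x = y) (hx : x ∈ p.dom) (hy : y ∈ p.dom) :
    p.hom ⟨x, hx⟩ = p.hom ⟨y, hy⟩ := by subst h; rfl

/-- `(I, f)` and `(J, g)` are equivalent if `f = g` on `I ∩ J`. -/
def Equivalent (p q : PartialHom A) : Prop :=
  ∀ (x : A) (hp : x ∈ p.dom) (hq : x ∈ q.dom), p.hom ⟨x, hp⟩ = q.hom ⟨x, hq⟩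

variable [IsPrimeRing A]

lemma Equivalent.trans {p q r : PartialHom A} (h1 : Equivalent p q) (h2 : Equivalent q r) :
    Equivalent p r := by
  intro x hp hr
  rw [← sub_eq_zero]
  refine eq_zero_of_mul_eq_zero q.dom_ne_bot fun y hy => ?_
  have e1 := hom_mul p.hom hp y (p.dom.mul_mem_right _ _ hp)
  have e2 := hom_mul r.hom hr y (r.dom.mul_mem_right _ _ hr)
  have hq : x * y ∈ q.dom := q.dom.mul_mem_left _ _ hy
  rw [sub_mul, ← e1, ← e2, h1 _ _ hq, h2 _ hq (r.dom.mul_mem_right _ _ hr), sub_self]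

variable (A) in
instance setoid : Setoid (PartialHom A) where
  r := Equivalent
  iseqv := ⟨fun _ _ _ _ => rfl, fun h x hp hq => (h x hq hp).symm, Equivalent.trans⟩

/-- `(A, x ↦ a x)`, the element of the ring of quotients given by `a : A`. -/
def ofElem (a : A) : PartialHom A where
  dom := ⊤
  dom_ne_bot := top_ne_bot'
  hom :=
    { toFun := fun x => a * x
      map_add' := fun x y => mul_add a x y
      map_smul' := fun b x => (mul_assoc a x b.unop).symm }

/-- `(I, f) + (J, g) = (I ∩ J, f + g)`. -/
def add (p q : PartialHom A) : PartialHom A where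
  dom := p.dom ⊓ q.dom
  dom_ne_bot := inf_ne_bot p.dom_ne_bot q.dom_ne_bot
  hom := restr inf_le_left p.hom + restr inf_le_right q.hom

/-- `-(I, f) = (I, -f)`. -/
def neg (p : PartialHom A) : PartialHom A where
  dom := p.dom
  dom_ne_bot := p.dom_ne_bot
  hom := -p.hom

/-- `(I, f) (J, g) = (JI, f ∘ g)`. -/
def mul (p q : PartialHom A) : PartialHom A where
  dom := idealMul q.dom p.dom
  dom_ne_bot := idealMul_ne_bot q.dom_ne_bot p.dom_ne_bot
  hom :=
    { toFun := fun x => p.hom ⟨q.hom ⟨x, idealMul_le_left x.2⟩, hom_mem q.hom x.2⟩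
      map_add' := fun x y => by
        rw [← p.hom.map_add]
        congr 1
        exact Subtype.ext (q.hom.map_add ⟨x, idealMul_le_left x.2⟩ ⟨y, idealMul_le_left y.2⟩)
      map_smul' := fun a x => by
        rw [RingHom.id_apply, ← p.hom.map_smul]
        congr 1
        exact Subtype.ext (q.hom.map_smul a ⟨x, idealMul_le_left x.2⟩) }

end PartialHom

variable (A) in
/-- The (right) Martindale ring of quotients of a prime ring `A`: pairs `(I, f)` modulo
equivalence. -/
def MartindaleQuotient [IsPrimeRing A] : Type v := Quotient (PartialHom.setoid A)

namespace MartindaleQuotient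

open PartialHom

variable [IsPrimeRing A]

/-- The class of a pair `(I, f)`. -/
def mk (p : PartialHom A) : MartindaleQuotient A := Quotient.mk (PartialHom.setoid A) p

lemma sound {p q : PartialHom A} (h : Equivalent p q) : mk p = mk q :=
  Quotient.sound (s := PartialHom.setoid A) h

instance : Zero (MartindaleQuotient A) := ⟨mk (ofElem 0)⟩

instance : One (MartindaleQuotient A) := ⟨mk (ofElem 1)⟩

instance : Add (MartindaleQuotient A) :=
  ⟨Quotient.map₂ add fun _ _ h _ _ h' x hx hy =>
    congrArg₂ (· + ·) (h x hx.1 hy.1) (h' x hx.2 hy.2)⟩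

instance : Neg (MartindaleQuotient A) :=
  ⟨Quotient.map neg fun _ _ h x hx hy => congrArg (- ·) (h x hx hy)⟩

instance : Mul (MartindaleQuotient A) :=
  ⟨Quotient.map₂ mul fun p p' h q q' h' x hx hy => by
    have e := h' x (idealMul_le_left hx) (idealMul_le_left hy)
    have m := hom_mem q'.hom hy
    have m' := hom_mem q.hom hx
    exact (h _ m' (e ▸ m)).trans (congr_hom p' e _ m)⟩

instance : Ring (MartindaleQuotient A) where
  add_assoc := by
    rintro ⟨p⟩ ⟨q⟩ ⟨r⟩
    exact sound fun x h _ =>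
      add_assoc (p.hom ⟨x, h.1.1⟩) (q.hom ⟨x, h.1.2⟩) (r.hom ⟨x, h.2⟩)
  zero_add := by
    rintro ⟨p⟩
    exact sound fun x h h' => (congrArg (· + p.hom ⟨x, h'⟩) (zero_mul x)).trans (zero_add _)
  add_zero := by
    rintro ⟨p⟩
    exact sound fun x h h' => (congrArg (p.hom ⟨x, h'⟩ + ·) (zero_mul x)).trans (add_zero _)
  add_comm := by
    rintro ⟨p⟩ ⟨q⟩
    exact sound fun x h _ => add_comm (p.hom ⟨x, h.1⟩) (q.hom ⟨x, h.2⟩)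
  neg_add_cancel := by
    rintro ⟨p⟩
    exact sound fun x h _ => (neg_add_cancel (p.hom ⟨x, h.2⟩)).trans (zero_mul x).symm
  mul_assoc := by
    rintro ⟨p⟩ ⟨q⟩ ⟨r⟩
    exact sound fun x h h' => rfl
  one_mul := by
    rintro ⟨p⟩
    exact sound fun x h h' => one_mul (p.hom ⟨x, h'⟩)
  mul_one := by
    rintro ⟨p⟩
    exact sound fun x h h' => congr_hom p (one_mul x) _ h'
  left_distrib := by
    rintro ⟨p⟩ ⟨q⟩ ⟨r⟩
    exact sound fun x h h' => p.hom.map_add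
      ⟨q.hom ⟨x, idealMul_le_left h'.1⟩, hom_mem q.hom h'.1⟩
      ⟨r.hom ⟨x, idealMul_le_left h'.2⟩, hom_mem r.hom h'.2⟩
  right_distrib := by
    rintro ⟨p⟩ ⟨q⟩ ⟨r⟩
    exact sound fun x h h' => rfl
  zero_mul := by
    rintro ⟨p⟩
    exact sound fun x h h' => (zero_mul _).trans (zero_mul x).symm
  mul_zero := by
    rintro ⟨p⟩
    exact sound fun x h h' =>
      (congr_hom p (zero_mul x) _ p.dom.zero_mem).trans (p.hom.map_zero.trans (zero_mul x).symm)
  nsmul := nsmulRec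
  zsmul := zsmulRec

variable (A) in
/-- The embedding of `A` into its ring of quotients, `a ↦ (A, x ↦ a x)`. -/
def of : A →+* MartindaleQuotient A where
  toFun a := mk (ofElem a)
  map_one' := rfl
  map_mul' a b := sound fun x _ _ => mul_assoc a b x
  map_zero' := rfl
  map_add' a b := sound fun x _ _ => add_mul a b x

instance instAlgebra {k : Type*} [CommRing k] [Algebra k A] : Algebra k (MartindaleQuotient A) :=
  RingHom.toAlgebra' ((of A).comp (algebraMap k A)) (by
    rintro c ⟨p⟩
    refine sound fun x h h' => ?_
    have hx : x ∈ p.dom := idealMul_le_right h'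
    have e : algebraMap k A c * x = x * algebraMap k A c := Algebra.commutes c x
    have hx' : x * algebraMap k A c ∈ p.dom := p.dom.mul_mem_right _ _ hx
    calc algebraMap k A c * p.hom ⟨x, hx⟩ = p.hom ⟨x, hx⟩ * algebraMap k A c :=
          Algebra.commutes c _
      _ = p.hom ⟨x * algebraMap k A c, hx'⟩ := (hom_mul p.hom hx _ hx').symm
      _ = _ := congr_hom p e.symm hx' _)

end MartindaleQuotient

/-- The extended center `C(A)` of a prime `k`-algebra `A`: the center of the Martindale ring of
quotients, as a `k`-algebra. -/
abbrev extendedCenter (k : Type*) (A : Type v) [Field k] [Ring A] [Algebra k A] [IsPrimeRing A] :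
    Subalgebra k (MartindaleQuotient A) :=
  Subalgebra.center k (MartindaleQuotient A)

end Martindale

end JustInf

/-! A `d`-dimensional algebra satisfies the standard identity of degree `d + 1` and embeds in `d ×
d` matrices by its regular representation. Hence a nonzero ideal, having finite codimension,
contains the values of all identities of some matrix algebra, that is, some `I_n(A)`; and `I_n(A) =
0` would make `A` PI. If `IJ = 0` with both ideals nonzero, the product of the standard identities
of the two quotients would be an identity of `A`, so `A` is prime. The `I_n(A)` are thus a countable
family of nonzero ideals, one below every nonzero ideal. A central element of `Q(A)` is given by a
bimodule map, which may be restricted to some `I_n(A)`. By primeness a nonzero bimodule map is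
injective. Its inverse on its image makes `C(A)` a field, and evaluation at one nonzero element of
`I_n(A)` embeds the space of bimodule maps into `A`. So `C(A)` is covered by countably many spaces
of countable dimension. -/

namespace JustInf

/-! ### Standard identities and identities of finite dimensional algebras -/

section Identities

variable {k : Type*} [Field k]

/-- The standard polynomial of degree `n`, the alternating sum of all products of `x₀, …, xₙ₋₁`. -/
noncomputable def standardPolynomial (k : Type*) [Field k] (n : ℕ) : FreeAlgebra k ℕ :=
  MultilinearMap.alternatization (MultilinearMap.mkPiAlgebraFin k n (FreeAlgebra k ℕ))
    fun i => FreeAlgebra.ι k (i : ℕ)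

lemma standardPolynomial_eq_sum (n : ℕ) :
    standardPolynomial k n = ∑ σ : Equiv.Perm (Fin n), Equiv.Perm.sign σ •
      (List.ofFn fun i => FreeAlgebra.ι k (σ i : ℕ)).prod := by
  simp [standardPolynomial, MultilinearMap.alternatization_apply]

lemma lift_standardPolynomial {B : Type*} [Ring B] [Algebra k B] (n : ℕ) (x : ℕ → B) :
    FreeAlgebra.lift k x (standardPolynomial k n) =
      MultilinearMap.alternatization (MultilinearMap.mkPiAlgebraFin k n B) fun i => x i := by
  have (u : ℤˣ) (a : FreeAlgebra k ℕ) :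
      FreeAlgebra.lift k x (u • a) = u • FreeAlgebra.lift k x a := by
    rw [Units.smul_def, Units.smul_def, map_zsmul]
  simp [standardPolynomial, MultilinearMap.alternatization_apply, this, map_list_prod,
    List.map_ofFn, Function.comp_def]

lemma equivMonoidAlgebraFreeMonoid_prod_map_ι (l : List ℕ) :
    FreeAlgebra.equivMonoidAlgebraFreeMonoid (l.map (FreeAlgebra.ι k)).prod =
      MonoidAlgebra.single (FreeMonoid.ofList l) (1 : k) := by
  induction l with
  | nil => simp [MonoidAlgebra.one_def]
  | cons a l ih =>
    rw [List.map_cons, List.prod_cons, map_mul, ih, FreeMonoid.ofList_cons]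
    simp [FreeAlgebra.equivMonoidAlgebraFreeMonoid, MonoidAlgebra.single_mul_single]

/-- Distinct permutations give distinct words, so no cancellation occurs: the word `x₀ ⋯ xₙ₋₁` keeps
coefficient 1. -/
lemma standardPolynomial_ne_zero (n : ℕ) : standardPolynomial k n ≠ 0 := by
  intro h
  rw [standardPolynomial_eq_sum] at h
  have key (σ : Equiv.Perm (Fin n)) : FreeAlgebra.equivMonoidAlgebraFreeMonoid
      (Equiv.Perm.sign σ • (List.ofFn fun i => FreeAlgebra.ι k (σ i : ℕ)).prod) =
      Equiv.Perm.sign σ •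
        MonoidAlgebra.single (FreeMonoid.ofList (List.ofFn fun i => (σ i : ℕ))) (1 : k) := by
    rw [← equivMonoidAlgebraFreeMonoid_prod_map_ι, List.map_ofFn, Units.smul_def,
      Units.smul_def, map_zsmul]
    rfl
  have h' := congrArg
    (fun p => (FreeAlgebra.equivMonoidAlgebraFreeMonoid p).coeff
      (FreeMonoid.ofList (List.ofFn fun i : Fin n => (i : ℕ)))) h
  simp only [map_sum, key, map_zero, MonoidAlgebra.coeff_zero, Finsupp.coe_zero,
    Pi.zero_apply, MonoidAlgebra.coeff_sum, Finsupp.finsetSum_apply] at h'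
  rw [Finset.sum_eq_single 1] at h'
  · simp at h'
  · intro σ _ hσ
    rw [Units.smul_def, MonoidAlgebra.coeff_smul_apply, MonoidAlgebra.coeff_single,
      Finsupp.single_eq_of_ne, smul_zero]
    intro e
    refine hσ (Equiv.ext fun i => Fin.ext ?_)
    exact (congrFun (List.ofFn_injective (FreeMonoid.ofList.injective e)) i).symm
  · simp

/-- A finite dimensional algebra satisfies a standard identity. -/
lemma isIdentity_standardPolynomial {B : Type*} [Ring B] [Algebra k B] [Module.Finite k B] :
    IsIdentity k B (standardPolynomial k (Module.finrank k B + 1)) := by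
  intro x
  rw [lift_standardPolynomial]
  -- An alternating map vanishes on dependent families, and `dim B + 1` vectors of `B` are
  -- dependent.
  refine AlternatingMap.map_linearDependent _ _ fun h => ?_
  have := h.fintype_card_le_finrank
  simp at this

lemma IsIdentity.of_injective {B C : Type*} [Ring B] [Algebra k B] [Ring C] [Algebra k C]
    {f : FreeAlgebra k ℕ} (hf : IsIdentity k C f) (φ : B →ₐ[k] C)
    (hφ : Function.Injective φ) : IsIdentity k B f := by
  intro x
  apply hφ
  rw [map_zero, ← hf (φ ∘ x), ← AlgHom.comp_apply]
  congr 1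
  ext i
  simp

/-- The left regular representation of `B` is faithful because `B` is unital. -/
lemma IsIdentity.of_matrix {B : Type*} [Ring B] [Algebra k B] [Module.Finite k B]
    {f : FreeAlgebra k ℕ}
    (hf : IsIdentity k (Matrix (Fin (Module.finrank k B)) (Fin (Module.finrank k B)) k) f) :
    IsIdentity k B f :=
  hf.of_injective _ (Algebra.leftMulMatrix_injective (Module.finBasis k B))

/-- An identity of `A / I` takes values in `I`. -/
lemma IsIdentity.lift_mem {A : Type*} [Ring A] [Algebra k A] {I : TwoSidedIdeal A}
    {f : FreeAlgebra k ℕ} (hf : IsIdentity k I.ringCon.Quotient f) (x : ℕ → A) :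
    FreeAlgebra.lift k x f ∈ I := by
  have h := hf (I.ringCon.mkₐ k ∘ x)
  have e : FreeAlgebra.lift k (I.ringCon.mkₐ k ∘ x) =
      (I.ringCon.mkₐ k).comp (FreeAlgebra.lift k x) := by
    ext i
    simp
  rw [e] at h
  rw [← TwoSidedIdeal.ker_ringCon_mk' I, TwoSidedIdeal.mem_ker]
  exact h

end Identities

/-! ### Primeness and cofinality of the ideals `I_n(A)` -/

section JustInfinite

variable {k A : Type*} [Field k] [Ring A] [Algebra k A]

/-- Otherwise the standard polynomial of degree `n² + 1`, an identity of the matrix algebra, would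
be an identity of `A`. -/
lemma matIdeal_ne_bot (hPI : ¬ IsPI k A) (n : ℕ) : matIdeal k A n ≠ ⊥ := by
  intro h
  refine hPI ⟨_, standardPolynomial_ne_zero
    (Module.finrank k (Matrix (Fin n) (Fin n) k) + 1), fun x => ?_⟩
  rw [← TwoSidedIdeal.mem_bot, ← h]
  exact TwoSidedIdeal.subset_span ⟨_, isIdentity_standardPolynomial, x, rfl⟩

lemma exists_matIdeal_le (I : TwoSidedIdeal A) [Module.Finite k I.ringCon.Quotient] :
    ∃ n, 0 < n ∧ matIdeal k A n ≤ I := by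
  -- A zero quotient would give size 0, but a positive `n` is wanted; every polynomial is an
  -- identity of the zero ring, so `n = 1` serves.
  rcases Nat.eq_zero_or_pos (Module.finrank k I.ringCon.Quotient) with h | h
  · have := Module.finrank_zero_iff.1 h
    refine ⟨1, one_pos, TwoSidedIdeal.span_le.2 ?_⟩
    rintro _ ⟨f, -, x, rfl⟩
    exact IsIdentity.lift_mem (fun _ => Subsingleton.elim _ _) x
  · refine ⟨_, h, TwoSidedIdeal.span_le.2 ?_⟩
    rintro _ ⟨f, hf, x, rfl⟩
    exact hf.of_matrix.lift_mem x

/-- A just infinite algebra which is not PI is prime. -/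
lemma IsJustInfinite.isPrimeRing (hJI : IsJustInfinite k A) (hPI : ¬ IsPI k A) :
    IsPrimeRing A where
  nontrivial := by
    by_contra h
    rw [not_nontrivial_iff_subsingleton] at h
    exact hJI.infinite inferInstance
  eq_bot_or_eq_bot I J hIJ := by
    by_contra! h
    have := hJI.finite_codim I h.1
    have := hJI.finite_codim J h.2
    -- The free algebra is a domain, so the product of the two standard polynomials is nonzero; its
    -- values lie in `IJ = 0`.
    refine hPI ⟨_, mul_ne_zero
      (standardPolynomial_ne_zero (Module.finrank k I.ringCon.Quotient + 1))
      (standardPolynomial_ne_zero (Module.finrank k J.ringCon.Quotient + 1)), fun x => ?_⟩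
    rw [map_mul]
    exact hIJ _ (isIdentity_standardPolynomial.lift_mem x) _
      (isIdentity_standardPolynomial.lift_mem x)

/-- A countably generated algebra has countable dimension. -/
lemma IsCountablyGenerated.rank_le (h : IsCountablyGenerated k A) :
    Module.rank k A ≤ Cardinal.aleph0 := by
  obtain ⟨s, hs, h⟩ := h
  have := Algebra.rank_adjoin_le (R := k) s
  rw [h] at this
  rw [← rank_top k A]
  exact this.trans (max_le hs.le_aleph0 le_rfl)

end JustInfinite

end JustInf

namespace JustInf

/-! ### Bimodule homomorphisms on ideals of a prime ring -/

section BimoduleHom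

variable {A : Type*} [Ring A] {I : TwoSidedIdeal A} {f : I →ₗ[Aᵐᵒᵖ] A}

lemma IsBimoduleHom.map_mul (hf : IsBimoduleHom f) (a : A) {x : A} (hx : x ∈ I)
    (hax : a * x ∈ I) : f ⟨a * x, hax⟩ = a * f ⟨x, hx⟩ :=
  hf a ⟨x, hx⟩

lemma IsBimoduleHom.restr (hf : IsBimoduleHom f) {J : TwoSidedIdeal A} (h : J ≤ I) :
    IsBimoduleHom (PartialHom.restr h f) :=
  fun a x => hf a ⟨x, h x.2⟩

/-- In a prime ring a nonzero bimodule homomorphism on an ideal is injective. -/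
lemma IsBimoduleHom.eq_zero_of_map_eq_zero [IsPrimeRing A] (hf : IsBimoduleHom f) (hf0 : f ≠ 0)
    {x : I} (hx : f x = 0) : x = 0 := by
  let K : TwoSidedIdeal A := TwoSidedIdeal.mk' {x | ∃ h : x ∈ I, f ⟨x, h⟩ = 0}
    ⟨I.zero_mem, f.map_zero⟩
    (by
      rintro a b ⟨ha, ha'⟩ ⟨hb, hb'⟩
      exact ⟨I.add_mem ha hb, (f.map_add ⟨a, ha⟩ ⟨b, hb⟩).trans (by rw [ha', hb', add_zero])⟩)
    (by
      rintro a ⟨ha, ha'⟩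
      exact ⟨I.neg_mem ha, (f.map_neg ⟨a, ha⟩).trans (by rw [ha', neg_zero])⟩)
    (by
      rintro a b ⟨hb, hb'⟩
      exact ⟨I.mul_mem_left _ _ hb, by rw [hf.map_mul a hb, hb', mul_zero]⟩)
    (by
      rintro a b ⟨ha, ha'⟩
      exact ⟨I.mul_mem_right _ _ ha, by rw [PartialHom.hom_mul f ha, ha', zero_mul]⟩)
  have hK : ∀ x, x ∈ K ↔ ∃ h : x ∈ I, f ⟨x, h⟩ = 0 :=
    fun x => TwoSidedIdeal.mem_mk' _ _ _ _ _ _ x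
  by_contra hx0
  have hKbot : K ≠ ⊥ := by
    intro h
    have hxK : (x : A) ∈ K := (hK x).2 ⟨x.2, hx⟩
    rw [h, TwoSidedIdeal.mem_bot] at hxK
    exact hx0 (Subtype.ext hxK)
  -- The kernel `K` is a two-sided ideal, and for `z ∈ I`, `y ∈ K` one has `f(z) y = f(z y) = z f(y)
  -- = 0`.
  refine hf0 (LinearMap.ext fun z => eq_zero_of_mul_eq_zero hKbot fun y hy => ?_)
  obtain ⟨hyI, hy0⟩ := (hK y).1 hy
  have hzy : (z : A) * y ∈ I := I.mul_mem_left _ _ hyI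
  rw [← PartialHom.hom_mul f z.2 y hzy, hf.map_mul z hyI, hy0, mul_zero]

/-- Two homomorphisms that agree on a nonzero ideal are equal. -/
lemma hom_ext_of_le [IsPrimeRing A] {J : TwoSidedIdeal A} (hJ : J ≠ ⊥) (hJI : J ≤ I)
    {f g : I →ₗ[Aᵐᵒᵖ] A} (h : ∀ x : J, f ⟨x, hJI x.2⟩ = g ⟨x, hJI x.2⟩) : f = g := by
  ext x
  rw [← sub_eq_zero]
  refine eq_zero_of_mul_eq_zero hJ fun y hy => ?_
  have hxy : (x : A) * y ∈ J := J.mul_mem_left _ _ hy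
  rw [sub_mul, ← PartialHom.hom_mul f x.2 y (hJI hxy), ← PartialHom.hom_mul g x.2 y (hJI hxy),
    h ⟨_, hxy⟩, sub_self]

/-- The image of a bimodule homomorphism, as a two-sided ideal. -/
def IsBimoduleHom.image (hf : IsBimoduleHom f) : TwoSidedIdeal A :=
  TwoSidedIdeal.mk' (Set.range f) ⟨0, f.map_zero⟩
    (by rintro _ _ ⟨x, rfl⟩ ⟨y, rfl⟩; exact ⟨x + y, f.map_add x y⟩)
    (by rintro _ ⟨x, rfl⟩; exact ⟨-x, f.map_neg x⟩)
    (by rintro a _ ⟨x, rfl⟩; exact ⟨a • x, hf a x⟩)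
    (by rintro _ a ⟨x, rfl⟩; exact ⟨MulOpposite.op a • x, f.map_smul _ x⟩)

lemma IsBimoduleHom.mem_image (hf : IsBimoduleHom f) {y : A} :
    y ∈ hf.image ↔ ∃ x, f x = y :=
  TwoSidedIdeal.mem_mk' _ _ _ _ _ _ y

lemma IsBimoduleHom.image_ne_bot (hf : IsBimoduleHom f) (hf0 : f ≠ 0) : hf.image ≠ ⊥ := by
  intro h
  refine hf0 (LinearMap.ext fun x => ?_)
  have : f x ∈ hf.image := hf.mem_image.2 ⟨x, rfl⟩
  rwa [h, TwoSidedIdeal.mem_bot] at this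

/-- A nonzero bimodule homomorphism has a left inverse on its image. -/
lemma IsBimoduleHom.exists_leftInverse [IsPrimeRing A] (hf : IsBimoduleHom f) (hf0 : f ≠ 0) :
    ∃ g : hf.image →ₗ[Aᵐᵒᵖ] A, ∀ x, g ⟨f x, hf.mem_image.2 ⟨x, rfl⟩⟩ = x := by
  have inj : ∀ x y, f x = f y → x = y := fun x y h => sub_eq_zero.1
    (hf.eq_zero_of_map_eq_zero hf0 (by rw [map_sub, h, sub_self]))
  choose s hs using fun y : hf.image => hf.mem_image.1 y.2
  refine ⟨{ toFun := fun y => s y, map_add' := fun x y => ?_, map_smul' := fun a x => ?_ },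
    fun x => congrArg Subtype.val (inj _ _ (hs _))⟩
  · exact congrArg Subtype.val (inj (s (x + y)) (s x + s y) (by rw [map_add, hs, hs, hs]; rfl))
  · exact congrArg Subtype.val (inj (s (a • x)) (a • s x) (by rw [map_smul, hs, hs]; rfl))

variable (k : Type*) [Field k] [Algebra k A] (I) in
/-- The `k`-space of bimodule homomorphisms `I → A`. -/
def bimoduleHoms : Submodule k (I →ₗ[Aᵐᵒᵖ] A) where
  carrier := {f | IsBimoduleHom f}
  add_mem' {f g} hf hg a x := by
    rw [LinearMap.add_apply, LinearMap.add_apply, hf a x, hg a x, mul_add]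
  zero_mem' a x := by simp
  smul_mem' c f hf a x := by
    rw [LinearMap.smul_apply, LinearMap.smul_apply, hf a x, mul_smul_comm]

/-- Evaluation at a fixed nonzero `x ∈ I` is injective, since a nonzero bimodule map kills no
nonzero element. -/
lemma rank_bimoduleHoms_le (k : Type*) [Field k] [Algebra k A] [IsPrimeRing A] (hI : I ≠ ⊥) :
    Module.rank k (bimoduleHoms I k) ≤ Module.rank k A := by
  obtain ⟨x, hx, hx0⟩ : ∃ x ∈ I, x ≠ 0 := by
    by_contra! h
    exact hI (le_bot_iff.1 fun x hx => (TwoSidedIdeal.mem_bot _).2 (h x hx))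
  let e : bimoduleHoms I k →ₗ[k] A :=
    { toFun := fun f => f.1 ⟨x, hx⟩
      map_add' := fun _ _ => rfl
      map_smul' := fun _ _ => rfl }
  refine LinearMap.rank_le_of_injective e fun f g hfg => ?_
  by_contra hne
  have h0 : f.1 - g.1 ≠ 0 := fun h => hne (Subtype.ext (sub_eq_zero.1 h))
  have hmem : IsBimoduleHom (f.1 - g.1) := (bimoduleHoms I k).sub_mem f.2 g.2
  exact hx0 (congrArg Subtype.val
    (hmem.eq_zero_of_map_eq_zero h0 (x := ⟨x, hx⟩) (sub_eq_zero.2 hfg)))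

end BimoduleHom

/-! ### The extended center: field structure and dimension -/

section Center

variable {k A : Type*} [Field k] [Ring A] [Algebra k A] [IsPrimeRing A]

open MartindaleQuotient

/-- Commuting with the left multiplications `of A a` is exactly left linearity. Writing `x = x * 1 =
1 * x` puts `x` in the domains of both products, so the equality holds on all of `p.dom`. -/
lemma isBimoduleHom_of_mk_mem_extendedCenter {p : PartialHom A}
    (hp : mk p ∈ extendedCenter k A) : IsBimoduleHom p.hom := by
  intro a x
  have h := Quotient.exact (s := PartialHom.setoid A) (Subalgebra.mem_center_iff.1 hp (of A a))
  have h1 : (x : A) ∈ idealMul p.dom ⊤ := by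
    simpa using mul_mem_idealMul x.2 (show (1 : A) ∈ (⊤ : TwoSidedIdeal A) from trivial)
  have h2 : (x : A) ∈ idealMul ⊤ p.dom := by
    simpa using mul_mem_idealMul (show (1 : A) ∈ (⊤ : TwoSidedIdeal A) from trivial) x.2
  exact (h x h1 h2).symm

lemma isField_extendedCenter : IsField (extendedCenter k A) where
  exists_pair_ne := by
    refine ⟨0, 1, fun h => ?_⟩
    have h := Quotient.exact (s := PartialHom.setoid A) (congrArg Subtype.val h)
    have h01 : (0 : A) * 1 = 1 * 1 := h 1 trivial trivial
    have := IsPrimeRing.nontrivial (A := A)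
    simp at h01
  mul_comm x y := Subtype.ext (Subalgebra.mem_center_iff.1 y.2 x.1)
  mul_inv_cancel := by
    rintro ⟨⟨p⟩, hp⟩ hp0
    have hf : IsBimoduleHom p.hom := isBimoduleHom_of_mk_mem_extendedCenter hp
    have hf0 : p.hom ≠ 0 := fun h => hp0 <| Subtype.ext <| sound fun x hx _ => by
      rw [h]
      exact (zero_mul x).symm
    obtain ⟨g, hg⟩ := hf.exists_leftInverse hf0
    -- A left inverse is enough: `mk p` is central, so `d` is also a right inverse.
    let d : MartindaleQuotient A := mk ⟨hf.image, hf.image_ne_bot hf0, g⟩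
    have hdc : d * mk p = 1 := sound fun x hx _ =>
      (hg ⟨x, idealMul_le_left hx⟩).trans (one_mul x).symm
    have hcd : mk p * d = 1 := (Subalgebra.mem_center_iff.1 hp d).symm.trans hdc
    refine ⟨⟨d, Subalgebra.mem_center_iff.2 fun q => ?_⟩, Subtype.ext hcd⟩
    -- The inverse of a central element is central: insert `d * mk p = 1` and move `mk p` past `q`.
    calc q * d = d * mk p * (q * d) := by rw [hdc, one_mul]
      _ = d * (mk p * q) * d := by simp only [mul_assoc]
      _ = d * (q * mk p) * d := congrArg (d * · * d) (Subalgebra.mem_center_iff.1 hp q).symm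
      _ = d * q * (mk p * d) := by simp only [mul_assoc]
      _ = d * q := by rw [hcd, mul_one]

variable (k) in
/-- The class of a bimodule homomorphism on a fixed ideal, as a linear map. -/
def bimoduleHomsToQuotient {I : TwoSidedIdeal A} (hI : I ≠ ⊥) :
    bimoduleHoms I k →ₗ[k] MartindaleQuotient A where
  toFun f := mk ⟨I, hI, f.1⟩
  map_add' _ _ := sound fun _ _ _ => rfl
  map_smul' c f := by
    rw [RingHom.id_apply, Algebra.smul_def]
    exact sound fun x hx _ => Algebra.smul_def c (f.1 ⟨x, hx⟩)

/-- Every element of the extended center is represented on each sufficiently small ideal. -/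
lemma exists_bimoduleHom_of_mem_extendedCenter {ι : Type*} {J : ι → TwoSidedIdeal A}
    (hJ : ∀ i, J i ≠ ⊥) {P : ι → Prop} (hP : ∀ I : TwoSidedIdeal A, I ≠ ⊥ → ∃ i, P i ∧ J i ≤ I)
    {c : MartindaleQuotient A} (hc : c ∈ extendedCenter k A) :
    ∃ i, P i ∧ ∃ f : J i →ₗ[Aᵐᵒᵖ] A, IsBimoduleHom f ∧ c = mk ⟨J i, hJ i, f⟩ := by
  obtain ⟨p, rfl⟩ : ∃ p, mk p = c := Quotient.exists_rep c
  obtain ⟨i, hi, hle⟩ := hP p.dom p.dom_ne_bot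
  exact ⟨i, hi, PartialHom.restr hle p.hom,
    (isBimoduleHom_of_mk_mem_extendedCenter hc).restr hle, sound fun _ _ _ => rfl⟩

/-- A submodule covered by the ranges of countably many linear maps from spaces of countable
dimension has countable dimension. -/
lemma rank_le_aleph0_of_subset_iUnion_range {k V : Type*} [Field k] [AddCommGroup V] [Module k V]
    {ι : Type*} [Countable ι] {H : ι → Type*} [∀ i, AddCommGroup (H i)] [∀ i, Module k (H i)]
    (hH : ∀ i, Module.rank k (H i) ≤ Cardinal.aleph0) (T : ∀ i, H i →ₗ[k] V)
    {S : Submodule k V} (hS : ∀ v ∈ S, ∃ i, v ∈ LinearMap.range (T i)) :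
    Module.rank k S ≤ Cardinal.aleph0 := by
  let b := fun i => Module.Basis.ofVectorSpace k (H i)
  -- The images of bases of the `H i` form a countable set whose span contains `S`.
  let s : Set V := ⋃ i, Set.range (T i ∘ b i)
  have hs : s.Countable := Set.countable_iUnion fun i => by
    have : Countable (Module.Basis.ofVectorSpaceIndex k (H i)) := by
      rw [← Cardinal.mk_le_aleph0_iff, (b i).mk_eq_rank'']
      exact hH i
    exact Set.countable_range _
  have hle : S ≤ Submodule.span k s := fun v hv => by
    obtain ⟨i, hi⟩ := hS v hv
    rw [LinearMap.range_eq_map, ← (b i).span_eq, Submodule.map_span, ← Set.range_comp] at hi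
    exact Submodule.span_mono (Set.subset_iUnion (fun i => Set.range (T i ∘ b i)) i) hi
  exact (Submodule.rank_mono hle).trans ((rank_span_le s).trans hs.le_aleph0)

lemma rank_extendedCenter_le {ι : Type*} [Countable ι] {J : ι → TwoSidedIdeal A}
    (hJ : ∀ i, J i ≠ ⊥) (hle : ∀ I : TwoSidedIdeal A, I ≠ ⊥ → ∃ i, J i ≤ I)
    (hA : Module.rank k A ≤ Cardinal.aleph0) :
    Module.rank k (extendedCenter k A) ≤ Cardinal.aleph0 := by
  refine rank_le_aleph0_of_subset_iUnion_range
    (H := fun i => bimoduleHoms (J i) k) (S := Subalgebra.toSubmodule (extendedCenter k A))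
    (fun i => (rank_bimoduleHoms_le k (hJ i)).trans hA)
    (fun i => bimoduleHomsToQuotient k (hJ i)) fun c hc => ?_
  obtain ⟨i, -, f, hf, rfl⟩ := exists_bimoduleHom_of_mem_extendedCenter hJ (P := fun _ => True)
    (by simpa using hle) ((Subalgebra.mem_toSubmodule _).1 hc)
  exact ⟨i, ⟨f, hf⟩, rfl⟩

end Center

end JustInf

/-- A countably generated non-PI just infinite algebra `A` is prime, and its extended center is a
countable dimensional field extension of `k`. The ideals `I_n(A)`, `n ≥ 1`, are nonzero, every
nonzero ideal contains one of them, a bimodule map `I → A` is determined by its restriction to any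
`I_n(A) ⊆ I`, and every element of the extended center is the class of a bimodule map on
some `I_n(A)`. -/
theorem mainTheorem8 {k : Type*} {A : Type*} [Field k] [Ring A] [Algebra k A]
    (hcg : JustInf.IsCountablyGenerated k A) (hPI : ¬ JustInf.IsPI k A)
    (hJI : JustInf.IsJustInfinite k A) :
    ∃ _ : JustInf.IsPrimeRing A,
      (IsField (JustInf.extendedCenter k A) ∧
        Module.rank k (JustInf.extendedCenter k A) ≤ Cardinal.aleph0) ∧
      (∀ n : ℕ, 0 < n → JustInf.matIdeal k A n ≠ ⊥) ∧
      (∀ I : TwoSidedIdeal A, I ≠ ⊥ → ∃ n : ℕ, 0 < n ∧ JustInf.matIdeal k A n ≤ I) ∧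
      (∀ (I : TwoSidedIdeal A) (n : ℕ), 0 < n → ∀ hn : JustInf.matIdeal k A n ≤ I,
        ∀ f g : I →ₗ[Aᵐᵒᵖ] A, JustInf.IsBimoduleHom f → JustInf.IsBimoduleHom g →
          (∀ x : JustInf.matIdeal k A n, f ⟨x, hn x.2⟩ = g ⟨x, hn x.2⟩) → f = g) ∧
      (∀ c ∈ JustInf.extendedCenter k A, ∃ n : ℕ, 0 < n ∧
        ∃ (hn : JustInf.matIdeal k A n ≠ ⊥) (f : JustInf.matIdeal k A n →ₗ[Aᵐᵒᵖ] A),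
          JustInf.IsBimoduleHom f ∧
            c = JustInf.MartindaleQuotient.mk ⟨JustInf.matIdeal k A n, hn, f⟩) := by
  have := hJI.isPrimeRing hPI
  have hne := JustInf.matIdeal_ne_bot (k := k) (A := A) hPI
  have hle : ∀ I : TwoSidedIdeal A, I ≠ ⊥ → ∃ n : ℕ, 0 < n ∧ JustInf.matIdeal k A n ≤ I := by
    intro I hI
    have := hJI.finite_codim I hI
    exact JustInf.exists_matIdeal_le I
  -- For the dimension bound the family is indexed by all of `ℕ`; including `n = 0` is harmless, as
  -- `hne` covers it.
  refine ⟨this, ⟨JustInf.isField_extendedCenter, JustInf.rank_extendedCenter_le hne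
    (fun I hI => (hle I hI).imp fun _ h => h.2) hcg.rank_le⟩, fun n _ => hne n, hle,
    fun I n _ hn f g _ _ h => JustInf.hom_ext_of_le (hne n) hn h, fun c hc => ?_⟩
  obtain ⟨n, hn, f, hf, e⟩ := JustInf.exists_bimoduleHom_of_mem_extendedCenter hne hle hc
  exact ⟨n, hn, hne n, f, hf, e⟩
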